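/- **Setting.** Let $\mathcal A,\mathcal Y$ be finite non-empty sets of actions and states, $\mathcal P$ a set of policies, $\mathcal P_0\subseteq\mathcal P$ a finite non-empty set of benchmark policies, and $U,V:\mathcal A\times\mathcal P\times\mathcal Y\to[-1,1]$ the utilities of the Agent and of the Principal; $U(a,p,\pi),V(a,p,\pi)$ are their expectations over $y\sim\pi\in\Delta(\mathcal Y)$. Let $a^*(p,\pi)$ maximize $V(\cdot,p,\pi)$ over $\operatorname{argmax}_a U(a,p,\pi)$, and let $p^*(\pi)\in\operatorname{argmax}_{p\in\mathcal P_0}V(a^*(p,\pi),p,\pi)$, with ties broken arbitrarily. There are $T\ge1$ rounds and a sequence of states $y_{1:T}$. A forecasting algorithm $\mathcal F$ draws $\pi_t\in\Delta(\mathcal Y)$ from a discrete distribution that depends on $y_{1:t-1},\pi_{1:t-1}$. A choice rule $\psi$ (here $p^*$, or a constant $p_0\in\mathcal P_0$) gives the policy $p_t=\psi(\pi_t)$ and the recommendation $r_t=a^*(p_t,\pi_t)$, and the Agent draws $a_t\sim\mathcal L_t(y_{1:t-1},a_{1:t-1},r_{1:t},p_{1:t})$. Write $p_t,r_t,a_t$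 for the play under $\psi=p^*$ and $p_0,r_t^{p_0},a_t^{p_0}$ for the play under the constant rule $p_0$ (with the same forecasts). The policy regret of $\sigma^\dagger=(\mathcal F,p^*)$ is $$\mathrm{PR}(\sigma^\dagger,\mathcal L,y_{1:T})=\mathbb E_{\pi_{1:T}}\Big[\max_{p_0\in\mathcal P_0}\mathbb E_{a_{1:T},a^{p_0}_{1:T}}\Big[\tfrac1T\sum_{t=1}^T\big(V(a_t^{p_0},p_0,y_t)-V(a_t,p_t,y_t)\big)\Big]\Big].$$ **Forecasts.** Let $\mathcal E'=\mathcal E_3\cup\mathcal E_4$, where $\mathcal E_3$ consists of the events $\{a^*(p_0,\pi)=a\}$ and $\mathcal E_4$ of the events $\{p^*(\pi)=p,\ a^*(p,\pi)=a\}$, for $p_0,p\in\mathcal P_0$ and $a\in\mathcal A$ (so $|\mathcal E'|=2|\mathcal P_0||\mathcal A|$, counted as an indexed family). With states identified with their one-hot vectors, $\ell=\ln(|\mathcal Y||\mathcal E'|T)$ and $n_E=|\{t:\pi_t\in E\}|$, call $\mathcal F$ *$K$-unbiased on $\mathcal E'$* if for every sequence $y_{1:T}$ $$\mathbb E_{\pi_{1:T}}\Bigg[\max_{E\in\mathcal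 E'}\ \frac{\frac1T\big\|\sum_{t}\mathbf 1[\pi_t\in E](\pi_t-y_t)\big\|_1}{\frac{|\mathcal Y|\ell}{T}+\frac{|\mathcal Y|\sqrt{\ell\, n_E}}{T}}\Bigg]\le K .$$ This is the guarantee for which the forecasting algorithm of Noarov, Ramalingam, Roth and Xie (NRRX23) is used. **Assumptions**, for given $y_{1:T}$, $\mathcal L$, and every forecast sequence $\pi_{1:T}$ that $\mathcal F$ produces with positive probability against $y_{1:T}$. Each is required for $(p_{1:T},r_{1:T},a_{1:T})$ and, for every $p_0\in\mathcal P_0$, for $((p_0,\dots,p_0),r^{p_0}_{1:T},a^{p_0}_{1:T})$; $h,h'$ are $\mathcal A$-valued functions. 1. *No contextual swap regret*: $\mathbb E_{a_{1:T}}\big[\max_h\frac1T\sum_t\big(U(h(p_t,r_t,a_t),p_t,y_t)-U(a_t,p_t,y_t)\big)\big]\le\epsilon_{\rm swap}$. 2. *Alignment* with $M_1\ge0$ and $M_2\in\mathbb R$: for every action sequence of positive probability, with $\mathrm{UGap}=\frac1T\max_h\min_{h'}\sum_t\big(U(h(p_t,r_t,a_t),p_t,y_t)-U(h'(p_t,r_t),p_t,y_t)\big)$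 evaluated on the respective play, $\frac1T\sum_t\big(V(r_t,p_t,y_t)-V(a_t,p_t,y_t)\big)\le M_1\mathrm{UGap}+M_2$ under the rule $p^*$, and $\frac1T\sum_t\big(V(a^{p_0}_t,p_0,y_t)-V(r^{p_0}_t,p_0,y_t)\big)\le M_1\mathrm{UGap}+M_2$ under the constant rule $p_0$. 3. *No negative cross-swap-regret*: $\frac1T\mathbb E_{a_{1:T}}\big[\sum_tU(a_t,p_t,y_t)-\max_h\sum_tU(h(p_t,r_t),p_t,y_t)\big]\le\epsilon_{\rm neg}$. **Theorem.** There is an absolute constant $K_0>0$ such that for every $K\ge K_0$ there is a constant $C>0$, depending only on $K$, with the following property. For every game as above, every choice of $a^*$ and $p^*$, and every $T\ge1$, there is a forecasting algorithm that is $K$-unbiased on $\mathcal E'$; and for every such forecasting algorithm $\mathcal F$, every $\mathcal L$ and $y_{1:T}$, and all $\epsilon_{\rm swap},\epsilon_{\rm neg},M_2\in\mathbb R$ and $M_1\ge0$ for which Assumptions 1–3 hold, the mechanism $\sigma^\dagger=(\mathcal F,p^*)$ satisfies $$\mathrm{PR}(\sigma^\dagger,\mathcal L,y_{1:T})\le C\,|\mathcal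 Y|\sqrt{\frac{|\mathcal P_0||\mathcal A|}{T}}\,\sqrt{\ln\big(2|\mathcal Y||\mathcal P_0||\mathcal A|T\big)}+2\big(M_1(\epsilon_{\rm swap}+\epsilon_{\rm neg})+M_2\big).$$ -/

import Mathlib

namespace PrincipalAgent

/-- Expectation of a real function under a discrete distribution. It is only applied to bounded
functions, so the sum always converges. -/
noncomputable def expect {α : Type*} (μ : PMF α) (f : α → ℝ) : ℝ :=
  ∑' x, (μ x).toReal * f x

/-- The one-hot encoding of a state. -/
noncomputable def oneHot {Y : Type*} (y k : Y) : ℝ :=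
  open Classical in if y = k then 1 else 0

/-- A principal-agent stage game: Agent utility `U a p y`, Principal utility `V a p y`, both with
values in `[-1, 1]`, and a finite non-empty set `P₀` of benchmark policies. -/
structure Game (P A Y : Type*) where
  U : A → P → Y → ℝ
  V : A → P → Y → ℝ
  P₀ : Finset P
  P₀_nonempty : P₀.Nonempty
  U_mem : ∀ a p y, U a p y ∈ Set.Icc (-1 : ℝ) 1
  V_mem : ∀ a p y, V a p y ∈ Set.Icc (-1 : ℝ) 1

/-- An Agent learning algorithm. Its action distribution in (zero-based) round `t` depends on the
past states, the past actions, and the past and current recommendations and policies. -/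
abbrev AgentAlg (P A Y : Type*) :=
  (t : ℕ) → (Fin t → Y) → (Fin t → A) → (Fin (t + 1) → A) → (Fin (t + 1) → P) → PMF A

/-- Law of the Agent's action sequence for given states `y`, policies `p`, recommendations `r`. -/
noncomputable def actionLaw {P A Y : Type*} (L : AgentAlg P A Y) :
    (T : ℕ) → (Fin T → Y) → (Fin T → P) → (Fin T → A) → PMF (Fin T → A)
  | 0, _, _, _ => PMF.pure Fin.elim0
  | T + 1, y, p, r =>
      (actionLaw L T (fun i => y i.castSucc) (fun i => p i.castSucc)
          (fun i => r i.castSucc)).bind fun a =>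
        (L T (fun i => y i.castSucc) a r p).map fun b => Fin.snoc (α := fun _ => A) a b

/-- A max over `P₀` of a real function. -/
noncomputable def Game.maxBenchmark {P A Y : Type*} (G : Game P A Y) (f : P → ℝ) : ℝ :=
  G.P₀.sup' G.P₀_nonempty f

section Finite

variable {P A Y : Type*} [Fintype Y]

/-- A randomized forecasting algorithm: in round `t` it maps the past states and its own past
forecasts to a distribution over forecasts, a forecast being a point of the simplex over `Y`. -/
abbrev Forecaster (Y : Type*) [Fintype Y] :=
  (t : ℕ) → (Fin t → Y) → (Fin t → stdSimplex ℝ Y) → PMF (stdSimplex ℝ Y)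

/-- Law of the forecast sequence when the sequence of states is `y`. -/
noncomputable def forecastLaw (F : Forecaster Y) :
    (T : ℕ) → (Fin T → Y) → PMF (Fin T → stdSimplex ℝ Y)
  | 0, _ => PMF.pure Fin.elim0
  | T + 1, y =>
      (forecastLaw F T (fun i => y i.castSucc)).bind fun π =>
        (F T (fun i => y i.castSucc) π).map fun q =>
          Fin.snoc (α := fun _ => stdSimplex ℝ Y) π q

/-! Best responses to a prior. -/

/-- Agent's expected utility under the prior `π`. -/
noncomputable def Game.expU (G : Game P A Y) (a : A) (p : P) (π : stdSimplex ℝ Y) : ℝ :=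
  ∑ y, π.1 y * G.U a p y

/-- Principal's expected utility under the prior `π`. -/
noncomputable def Game.expV (G : Game P A Y) (a : A) (p : P) (π : stdSimplex ℝ Y) : ℝ :=
  ∑ y, π.1 y * G.V a p y

/-- The set of the Agent's best responses to policy `p` under the prior `π`. -/
def Game.bestResponses (G : Game P A Y) (p : P) (π : stdSimplex ℝ Y) : Set A :=
  {a | ∀ b, G.expU b p π ≤ G.expU a p π}

/-- `aStar` selects an Agent best response that is best for the Principal (remaining ties are
broken arbitrarily). -/
def Game.IsBestResponse (G : Game P A Y) (aStar : P → stdSimplex ℝ Y → A) : Prop :=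
  ∀ p π, aStar p π ∈ G.bestResponses p π ∧
    ∀ b ∈ G.bestResponses p π, G.expV b p π ≤ G.expV (aStar p π) p π

/-- `pStar` selects an optimal benchmark policy, given that the Agent responds with `aStar`
(ties are broken arbitrarily). -/
def Game.IsOptimalPolicy (G : Game P A Y) (aStar : P → stdSimplex ℝ Y → A)
    (pStar : stdSimplex ℝ Y → P) : Prop :=
  ∀ π, pStar π ∈ G.P₀ ∧
    ∀ p ∈ G.P₀, G.expV (aStar p π) p π ≤ G.expV (aStar (pStar π) π) (pStar π) π

/-! Conditional bias of forecasts. -/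

/-- The bias of the forecasts `π` on the event `E`: the `ℓ₁` norm of
`(1 / T) ∑ₜ 1[πₜ ∈ E] (πₜ - yₜ)`. -/
noncomputable def condBias {T : ℕ} (y : Fin T → Y) (π : Fin T → stdSimplex ℝ Y)
    (E : Set (stdSimplex ℝ Y)) : ℝ :=
  (1 / (T : ℝ)) * ∑ k : Y, |∑ t, E.indicator (fun q => q.1 k - oneHot (y t) k) (π t)|

/-- The number of rounds in which the event `E` occurs. -/
noncomputable def eventCount {T : ℕ} (π : Fin T → stdSimplex ℝ Y)
    (E : Set (stdSimplex ℝ Y)) : ℕ :=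
  {t | π t ∈ E}.ncard

/-- With `ℓ = log (|Y| m T)` for a collection of `m` events:
`|Y| ℓ / T + |Y| √(ℓ #{t | πₜ ∈ E}) / T`. -/
noncomputable def biasRate (m : ℕ) {T : ℕ} (π : Fin T → stdSimplex ℝ Y)
    (E : Set (stdSimplex ℝ Y)) : ℝ :=
  (Fintype.card Y : ℝ) * Real.log (Fintype.card Y * m * T) / T +
    (Fintype.card Y : ℝ) * √(Real.log (Fintype.card Y * m * T) * eventCount π E) / T

/-- The forecaster is unbiased conditional on the finite family `E` of events over the horizon
`T`: for every sequence of states, the largest ratio (over the events) of the conditional bias to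
`biasRate` is at most `K` in expectation. -/
def IsUnbiasedForecaster (K : ℝ) (F : Forecaster Y) (T : ℕ) {ι : Type*} [Fintype ι]
    (E : ι → Set (stdSimplex ℝ Y)) : Prop :=
  ∀ y : Fin T → Y,
    expect (forecastLaw F T y)
      (fun π => ⨆ i, condBias y π (E i) / biasRate (Fintype.card ι) π (E i)) ≤ K

/-- The events `aStar p₀ π = a`, for `p₀ ∈ P₀` and `a ∈ A`. -/
def Game.eventsConst (G : Game P A Y) (aStar : P → stdSimplex ℝ Y → A) :
    G.P₀ × A → Set (stdSimplex ℝ Y) :=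
  fun i => {π | aStar i.1 π = i.2}

/-- The events `pStar π = p ∧ aStar p π = a`, for `p ∈ P₀` and `a ∈ A`. -/
def Game.eventsMech (G : Game P A Y) (aStar : P → stdSimplex ℝ Y → A)
    (pStar : stdSimplex ℝ Y → P) : G.P₀ × A → Set (stdSimplex ℝ Y) :=
  fun i => {π | pStar π = i.1 ∧ aStar i.1 π = i.2}

/-- The union of the two collections of events. -/
def Game.events (G : Game P A Y) (aStar : P → stdSimplex ℝ Y → A)
    (pStar : stdSimplex ℝ Y → P) : (G.P₀ × A) ⊕ (G.P₀ × A) → Set (stdSimplex ℝ Y) :=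
  Sum.elim (G.eventsConst aStar) (G.eventsMech aStar pStar)

/-! Policies and recommendations generated from forecasts. -/

/-- Policies chosen by the rule `ψ`. The constant mechanism of `p₀` is `ψ = fun _ => p₀`. -/
def policies {T : ℕ} (ψ : stdSimplex ℝ Y → P) (π : Fin T → stdSimplex ℝ Y) : Fin T → P :=
  fun t => ψ (π t)

/-- The recommendations made together with the policies chosen by the rule `ψ`. -/
def recs {T : ℕ} (aStar : P → stdSimplex ℝ Y → A) (ψ : stdSimplex ℝ Y → P)
    (π : Fin T → stdSimplex ℝ Y) : Fin T → A :=
  fun t => aStar (ψ (π t)) (π t)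

/-- Law of the Agent's actions under the choice rule `ψ` and realized forecasts `π`. -/
noncomputable def playLaw {T : ℕ} (L : AgentAlg P A Y) (aStar : P → stdSimplex ℝ Y → A)
    (y : Fin T → Y) (π : Fin T → stdSimplex ℝ Y) (ψ : stdSimplex ℝ Y → P) : PMF (Fin T → A) :=
  actionLaw L T y (policies ψ π) (recs aStar ψ π)

/-! The Principal's policy regret. -/

/-- Policy regret for realized forecasts `π`, in expectation over the Agent's randomness. -/
noncomputable def Game.regretGiven (G : Game P A Y) (aStar : P → stdSimplex ℝ Y → A)
    (ψ : stdSimplex ℝ Y → P) (L : AgentAlg P A Y) {T : ℕ} (y : Fin T → Y)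
    (π : Fin T → stdSimplex ℝ Y) : ℝ :=
  G.maxBenchmark fun p₀ =>
    expect (playLaw L aStar y π fun _ => p₀) fun a₀ =>
      expect (playLaw L aStar y π ψ) fun a =>
        (1 / (T : ℝ)) * ∑ t, (G.V (a₀ t) p₀ (y t) - G.V (a t) (ψ (π t)) (y t))

/-- Policy regret of the mechanism that consists of the forecaster `F` and the rule `ψ`. -/
noncomputable def Game.policyRegret (G : Game P A Y) (aStar : P → stdSimplex ℝ Y → A)
    (F : Forecaster Y) (ψ : stdSimplex ℝ Y → P) (L : AgentAlg P A Y) {T : ℕ}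
    (y : Fin T → Y) : ℝ :=
  expect (forecastLaw F T y) fun π => G.regretGiven aStar ψ L y π

end Finite

/-! Regret notions of the Agent. All suprema and infima are over finitely many bounded values. -/

/-- The Agent's contextual swap regret when his actions have law `μ`. -/
noncomputable def Game.swapReg {P A Y : Type*} (G : Game P A Y) {T : ℕ} (y : Fin T → Y)
    (p : Fin T → P) (r : Fin T → A) (μ : PMF (Fin T → A)) : ℝ :=
  expect μ fun a => ⨆ h : P × A × A → A,
    (1 / (T : ℝ)) * ∑ t, (G.U (h (p t, r t, a t)) (p t) (y t) - G.U (a t) (p t) (y t))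

/-- The gap between the best modification of (policy, recommendation, action) and the best
modification of (policy, recommendation). -/
noncomputable def Game.uGap {P A Y : Type*} (G : Game P A Y) {T : ℕ} (y : Fin T → Y)
    (p : Fin T → P) (r : Fin T → A) (a : Fin T → A) : ℝ :=
  (1 / (T : ℝ)) * ⨆ h : P × A × A → A, ⨅ h' : P × A → A,
    ∑ t, (G.U (h (p t, r t, a t)) (p t) (y t) - G.U (h' (p t, r t)) (p t) (y t))

/-- The Agent's negative cross-swap-regret when his actions have law `μ`. -/
noncomputable def Game.negReg {P A Y : Type*} (G : Game P A Y) {T : ℕ} (y : Fin T → Y)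
    (p : Fin T → P) (r : Fin T → A) (μ : PMF (Fin T → A)) : ℝ :=
  (1 / (T : ℝ)) * expect μ fun a =>
    (∑ t, G.U (a t) (p t) (y t)) - ⨆ h : P × A → A, ∑ t, G.U (h (p t, r t)) (p t) (y t)

section Assumptions

variable {P A Y : Type*} [Fintype Y]

/-- No contextual swap regret, for realized forecasts `π`, under the rule `ψ` and under every
constant mechanism. -/
def Game.NoContextualSwapRegret (G : Game P A Y) (aStar : P → stdSimplex ℝ Y → A)
    (ψ : stdSimplex ℝ Y → P) (L : AgentAlg P A Y) {T : ℕ} (y : Fin T → Y)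
    (π : Fin T → stdSimplex ℝ Y) (εswap : ℝ) : Prop :=
  G.swapReg y (policies ψ π) (recs aStar ψ π) (playLaw L aStar y π ψ) ≤ εswap ∧
  ∀ p₀ ∈ G.P₀, G.swapReg y (fun _ => p₀) (recs aStar (fun _ => p₀) π)
    (playLaw L aStar y π fun _ => p₀) ≤ εswap

/-- Alignment, for realized forecasts `π` and every action sequence that the Agent may play,
under the rule `ψ` and under every constant mechanism. -/
def Game.Alignment (G : Game P A Y) (aStar : P → stdSimplex ℝ Y → A)
    (ψ : stdSimplex ℝ Y → P) (L : AgentAlg P A Y) {T : ℕ} (y : Fin T → Y)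
    (π : Fin T → stdSimplex ℝ Y) (M₁ M₂ : ℝ) : Prop :=
  (∀ a ∈ (playLaw L aStar y π ψ).support,
    (1 / (T : ℝ)) * ∑ t, (G.V (recs aStar ψ π t) (ψ (π t)) (y t) - G.V (a t) (ψ (π t)) (y t)) ≤
      M₁ * G.uGap y (policies ψ π) (recs aStar ψ π) a + M₂) ∧
  ∀ p₀ ∈ G.P₀, ∀ a ∈ (playLaw L aStar y π fun _ => p₀).support,
    (1 / (T : ℝ)) * ∑ t, (G.V (a t) p₀ (y t) - G.V (recs aStar (fun _ => p₀) π t) p₀ (y t)) ≤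
      M₁ * G.uGap y (fun _ => p₀) (recs aStar (fun _ => p₀) π) a + M₂

/-- No negative cross-swap-regret, for realized forecasts `π`, under the rule `ψ` and under every
constant mechanism. -/
def Game.NoNegativeCrossSwapRegret (G : Game P A Y) (aStar : P → stdSimplex ℝ Y → A)
    (ψ : stdSimplex ℝ Y → P) (L : AgentAlg P A Y) {T : ℕ} (y : Fin T → Y)
    (π : Fin T → stdSimplex ℝ Y) (εneg : ℝ) : Prop :=
  G.negReg y (policies ψ π) (recs aStar ψ π) (playLaw L aStar y π ψ) ≤ εneg ∧
  ∀ p₀ ∈ G.P₀, G.negReg y (fun _ => p₀) (recs aStar (fun _ => p₀) π)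
    (playLaw L aStar y π fun _ => p₀) ≤ εneg

end Assumptions

end PrincipalAgent

open PrincipalAgent

/-! Regret bound. For realized forecasts, the regret against `p₀` splits into the Agent's deviation
from the recommendations under `p₀`, the same under `pStar`, and the regret of the recommendations
themselves (`Game.recRegret`). Alignment bounds the two deviations by the utility gap, whose
expectation is at most swap regret plus negative regret (`Game.uGap_le`). For the third term, fix
the recommendation (and the policy, under `pStar`): the payoff is then a fixed function of the
state, so replacing states by forecasts costs at most the conditional biases
(`abs_sum_mul_forecast_sub_le`), and under the forecasts `pStar` is optimal. The events of each
family are disjoint with counts adding up to `T`, so Cauchy–Schwarz turns the bias rates into the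
stated rate (`sum_biasRate_fibers_le`).

Existence of forecasts. For an event with cumulative error `X` and count `N`, consider the potential
summing `exp (η X - 2 η² N)` over events, coordinates and a grid of rates `±η`. One round increases
it by at most an expression linear in the forecasting error, which has mean zero if the state is
drawn from the forecast. By minimax, some random forecast keeps the expected increase below `ε` for
every state. The final potential then controls every bias at once, using the rate tuned to the
realized count. -/

namespace PrincipalAgent

/-! ### Expectations of bounded functions under discrete distributions. -/

section Expectation

variable {α β : Type*}

theorem summable_toReal_mul (μ : PMF α) {f : α → ℝ} (hf : ∃ B, ∀ x, |f x| ≤ B) :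
    Summable fun x => (μ x).toReal * f x := by
  obtain ⟨B, hB⟩ := hf
  have hμ : Summable fun x => (μ x).toReal := ENNReal.summable_toReal μ.tsum_coe_ne_top
  refine Summable.of_norm_bounded (hμ.mul_right B) fun x => ?_
  rw [Real.norm_eq_abs, abs_mul, abs_of_nonneg ENNReal.toReal_nonneg]
  exact mul_le_mul_of_nonneg_left (hB x) ENNReal.toReal_nonneg

theorem expect_const (μ : PMF α) (c : ℝ) : expect μ (fun _ => c) = c := by
  unfold expect
  rw [tsum_mul_right, ← ENNReal.tsum_toReal_eq μ.apply_ne_top, μ.tsum_coe]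
  simp

theorem expect_add (μ : PMF α) {f g : α → ℝ} (hf : ∃ B, ∀ x, |f x| ≤ B)
    (hg : ∃ B, ∀ x, |g x| ≤ B) :
    expect μ (fun x => f x + g x) = expect μ f + expect μ g := by
  unfold expect
  rw [← (summable_toReal_mul μ hf).tsum_add (summable_toReal_mul μ hg)]
  simp only [mul_add]

theorem expect_const_mul (μ : PMF α) (c : ℝ) (f : α → ℝ) :
    expect μ (fun x => c * f x) = c * expect μ f := by
  unfold expect
  rw [← tsum_mul_left]
  exact tsum_congr fun x => by ring

theorem expect_mono (μ : PMF α) {f g : α → ℝ} (hf : ∃ B, ∀ x, |f x| ≤ B)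
    (hg : ∃ B, ∀ x, |g x| ≤ B) (h : ∀ x ∈ μ.support, f x ≤ g x) :
    expect μ f ≤ expect μ g := by
  refine (summable_toReal_mul μ hf).tsum_le_tsum (fun x => ?_) (summable_toReal_mul μ hg)
  by_cases hx : x ∈ μ.support
  · exact mul_le_mul_of_nonneg_left (h x hx) ENNReal.toReal_nonneg
  · rw [PMF.mem_support_iff, not_not] at hx
    simp [hx]

theorem bounded_const (c : ℝ) : ∃ B, ∀ _ : α, |c| ≤ B := ⟨|c|, fun _ => le_rfl⟩

theorem bounded_add {f g : α → ℝ} (hf : ∃ B, ∀ x, |f x| ≤ B) (hg : ∃ B, ∀ x, |g x| ≤ B) :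
    ∃ B, ∀ x, |f x + g x| ≤ B := by
  obtain ⟨B, hB⟩ := hf
  obtain ⟨D, hD⟩ := hg
  exact ⟨B + D, fun x => (abs_add_le _ _).trans (add_le_add (hB x) (hD x))⟩

theorem bounded_const_mul (c : ℝ) {f : α → ℝ} (hf : ∃ B, ∀ x, |f x| ≤ B) :
    ∃ B, ∀ x, |c * f x| ≤ B := by
  obtain ⟨B, hB⟩ := hf
  exact ⟨|c| * B, fun x => by rw [abs_mul]; exact mul_le_mul_of_nonneg_left (hB x) (abs_nonneg c)⟩

theorem bounded_sum {ι : Type*} (s : Finset ι) {f : ι → α → ℝ}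
    (hf : ∀ i ∈ s, ∃ B, ∀ x, |f i x| ≤ B) : ∃ B, ∀ x, |∑ i ∈ s, f i x| ≤ B := by
  classical
  induction s using Finset.induction_on with
  | empty => exact ⟨0, by simp⟩
  | insert i s hi ih =>
    simp only [Finset.sum_insert hi]
    exact bounded_add (hf i (Finset.mem_insert_self i s))
      (ih fun j hj => hf j (Finset.mem_insert_of_mem hj))

theorem bounded_of_finite [Finite α] (f : α → ℝ) : ∃ B, ∀ x, |f x| ≤ B := by
  obtain ⟨B, hB⟩ := (Set.finite_range fun x => |f x|).bddAbove
  exact ⟨B, fun x => hB ⟨x, rfl⟩⟩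

theorem abs_expect_le (μ : PMF α) {f : α → ℝ} {B : ℝ} (hf : ∀ x, |f x| ≤ B) :
    |expect μ f| ≤ B := by
  have h1 := expect_mono μ ⟨B, hf⟩ (bounded_const B) fun x _ => (abs_le.1 (hf x)).2
  have h2 := expect_mono μ (bounded_const (-B)) ⟨B, hf⟩ fun x _ => (abs_le.1 (hf x)).1
  rw [expect_const] at h1 h2
  exact abs_le.2 ⟨h2, h1⟩

theorem ofReal_expect (μ : PMF α) {f : α → ℝ} (hf : ∃ B, ∀ x, |f x| ≤ B) (h0 : ∀ x, 0 ≤ f x) :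
    ENNReal.ofReal (expect μ f) = ∑' x, μ x * ENNReal.ofReal (f x) := by
  unfold expect
  rw [ENNReal.ofReal_tsum_of_nonneg (fun x => mul_nonneg ENNReal.toReal_nonneg (h0 x))
    (summable_toReal_mul μ hf)]
  refine tsum_congr fun x => ?_
  rw [ENNReal.ofReal_mul ENNReal.toReal_nonneg, ENNReal.ofReal_toReal (μ.apply_ne_top x)]

theorem expect_nonneg (μ : PMF α) {f : α → ℝ} (h0 : ∀ x, 0 ≤ f x) : 0 ≤ expect μ f :=
  tsum_nonneg fun x => mul_nonneg ENNReal.toReal_nonneg (h0 x)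

theorem expect_bind (μ : PMF α) (ν : α → PMF β) {f : β → ℝ} (hf : ∃ B, ∀ x, |f x| ≤ B) :
    expect (μ.bind ν) f = expect μ fun x => expect (ν x) f := by
  obtain ⟨B, hB⟩ := hf
  -- Nonnegative functions are handled by Tonelli in `ENNReal`; adding the bound `B` reduces the
  -- general case to this one.
  have key : ∀ g : β → ℝ, (∃ B, ∀ x, |g x| ≤ B) → (∀ x, 0 ≤ g x) →
      expect (μ.bind ν) g = expect μ fun x => expect (ν x) g := by
    rintro g ⟨D, hD⟩ h0
    have hν : ∀ x, 0 ≤ expect (ν x) g := fun x => expect_nonneg _ h0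
    refine (ENNReal.ofReal_eq_ofReal_iff (expect_nonneg _ h0) (expect_nonneg _ hν)).1 ?_
    rw [ofReal_expect _ ⟨D, hD⟩ h0,
      ofReal_expect _ ⟨D, fun x => abs_expect_le (ν x) hD⟩ hν]
    simp_rw [ofReal_expect (ν _) ⟨D, hD⟩ h0, PMF.bind_apply, ← ENNReal.tsum_mul_right,
      ← ENNReal.tsum_mul_left]
    rw [ENNReal.tsum_comm]
    simp only [mul_assoc]
  have h := key (fun x => f x + B) (bounded_add ⟨B, hB⟩ (bounded_const B))
    fun x => by linarith [(abs_le.1 (hB x)).1]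
  have hν : ∀ x, expect (ν x) (fun z => f z + B) = expect (ν x) f + B := fun x => by
    rw [expect_add _ ⟨B, hB⟩ (bounded_const B), expect_const]
  simp_rw [hν] at h
  rw [expect_add _ ⟨B, hB⟩ (bounded_const B),
    expect_add _ ⟨B, fun x => abs_expect_le (ν x) hB⟩ (bounded_const B), expect_const,
    expect_const] at h
  exact add_right_cancel h

theorem expect_pure (x : α) (f : α → ℝ) : expect (PMF.pure x) f = f x := by
  classical
  unfold expect
  rw [tsum_eq_single x fun z hz => by simp [hz]]
  simp

theorem expect_map (μ : PMF α) (e : α → β) {f : β → ℝ} (hf : ∃ B, ∀ x, |f x| ≤ B) :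
    expect (μ.map e) f = expect μ fun x => f (e x) := by
  rw [PMF.map, expect_bind _ _ hf]
  simp only [Function.comp, expect_pure]

end Expectation

/-! ### Minimax by separation of convex sets. -/

section Minimax

variable {Y : Type*}

theorem exists_pmf_of_mem_convexHull {α : Type*} {g : α → Y → ℝ}
    (hb : ∀ y, ∃ B, ∀ q, |g q y| ≤ B) {x : Y → ℝ} (hx : x ∈ convexHull ℝ (Set.range g)) :
    ∃ μ : PMF α, ∀ y, expect μ (fun q => g q y) = x y := by
  obtain ⟨ι, _, w, z, hw0, hw1, hz, rfl⟩ := mem_convexHull_iff_exists_fintype.1 hx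
  choose e he using hz
  have hsum : ∑ i, ENNReal.ofReal (w i) = 1 := by
    rw [← ENNReal.ofReal_sum_of_nonneg fun i _ => hw0 i, hw1, ENNReal.ofReal_one]
  refine ⟨(PMF.ofFintype (fun i => ENNReal.ofReal (w i)) hsum).map e, fun y => ?_⟩
  rw [expect_map _ _ (hb y), expect, tsum_fintype, Finset.sum_apply]
  refine Finset.sum_congr rfl fun i _ => ?_
  rw [PMF.ofFintype_apply, ENNReal.toReal_ofReal (hw0 i), he, Pi.smul_apply, smul_eq_mul]

variable [Fintype Y]

/-- A minimax principle: if every mixed action of the opponent has a response with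
non-positive loss, then some mixed response has loss at most `ε` against every pure action. -/
theorem exists_pmf_expect_le (g : stdSimplex ℝ Y → Y → ℝ) (hb : ∀ y, ∃ B, ∀ q, |g q y| ≤ B)
    (hg : ∀ q : stdSimplex ℝ Y, ∑ y, q.1 y * g q y ≤ 0) [Nonempty Y] {ε : ℝ} (hε : 0 < ε) :
    ∃ μ : PMF (stdSimplex ℝ Y), ∀ y, expect μ (fun q => g q y) ≤ ε := by
  classical
  suffices h : ∃ x ∈ convexHull ℝ (Set.range g), ∀ y, x y < ε by
    obtain ⟨x, hx, hxε⟩ := h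
    obtain ⟨μ, hμ⟩ := exists_pmf_of_mem_convexHull hb hx
    exact ⟨μ, fun y => (hμ y).trans_le (hxε y).le⟩
  by_contra! hcon
  -- The loss `g` need not be continuous in the forecast, so the hull need not be closed. The slack
  -- `ε` makes separation from an open orthant sufficient.
  have hdisj : Disjoint (Set.univ.pi fun _ : Y => Set.Iio ε) (convexHull ℝ (Set.range g)) := by
    rw [Set.disjoint_left]
    intro x hx hxC
    obtain ⟨y, hy⟩ := hcon x hxC
    exact absurd (hx y trivial) (not_lt.2 hy)
  obtain ⟨f, u, hO, hC⟩ := geometric_hahn_banach_open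
    (convex_pi fun (_ : Y) _ => convex_Iio ε)
    (isOpen_set_pi Set.finite_univ fun (_ : Y) _ => isOpen_Iio) (convex_convexHull ℝ _) hdisj
  set w : Y → ℝ := fun y => f (Pi.single y 1) with hw
  have hf : ∀ x, f x = ∑ y, w y * x y := fun x => by
    conv_lhs => rw [← Finset.univ_sum_single x, map_sum]
    refine Finset.sum_congr rfl fun y _ => ?_
    have : (Pi.single y (x y) : Y → ℝ) = x y • Pi.single y 1 := by
      rw [← Pi.single_smul, smul_eq_mul, mul_one]
    rw [this, map_smul, smul_eq_mul, mul_comm]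
  have hu : 0 < u := by
    have := hO 0 fun _ _ => hε
    rwa [map_zero] at this
  have hw0 : ∀ y, 0 ≤ w y := fun y => by
    by_contra! hy
    -- A negative weight would put in the orthant a point where the functional equals `u`, although
    -- it is strictly below `u` there.
    have := hO ((u / w y) • Pi.single y 1) fun k _ => by
      have h1 : u / w y ≤ 0 := (div_neg_of_pos_of_neg hu hy).le
      have h2 : (0 : ℝ) ≤ (Pi.single y (1 : ℝ) : Y → ℝ) k := by
        by_cases hk : k = y
        · subst hk; simp
        · simp [hk]
      exact (mul_nonpos_of_nonpos_of_nonneg h1 h2).trans_lt hε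
    rw [map_smul, smul_eq_mul, div_mul_cancel₀ _ hy.ne] at this
    exact lt_irrefl _ this
  have hgu : ∀ q, u ≤ ∑ y, w y * g q y := fun q => by
    rw [← hf]
    exact hC _ (subset_convexHull ℝ _ ⟨q, rfl⟩)
  have hW : 0 < ∑ y, w y := by
    refine lt_of_le_of_ne (Finset.sum_nonneg fun y _ => hw0 y) fun h => ?_
    have hz := (Finset.sum_eq_zero_iff_of_nonneg fun y _ => hw0 y).1 h.symm
    obtain ⟨y₀⟩ := ‹Nonempty Y›
    have := hgu ⟨Pi.single y₀ 1, single_mem_stdSimplex ℝ y₀⟩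
    rw [Finset.sum_eq_zero fun y hy => by rw [hz y hy, zero_mul]] at this
    exact absurd this (not_le.2 hu)
  -- The normalized separating functional is a prior against which the response `q` itself has
  -- positive loss.
  let q : stdSimplex ℝ Y := ⟨fun y => w y / ∑ k, w k, fun y => div_nonneg (hw0 y) hW.le, by
    rw [← Finset.sum_div, div_self hW.ne']⟩
  have h1 := hgu q
  have h2 : ∑ y, w y * g q y = (∑ k, w k) * ∑ y, q.1 y * g q y := by
    rw [Finset.mul_sum]
    refine Finset.sum_congr rfl fun y _ => ?_
    change _ = _ * (w y / (∑ k, w k) * g q y)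
    field_simp
  rw [h2] at h1
  exact absurd (h1.trans (mul_nonpos_of_nonneg_of_nonpos hW.le (hg q))) (not_le.2 hu)

end Minimax

/-- Combine `exp z ≤ 1 + z + z²` and `1 + 2z² ≤ exp (2z²)`: the product `(1 + z)(1 + 2z²)` exceeds
`1 + z + z²` by `z²(1 + 2z) ≥ 0`. -/
theorem exp_sub_two_mul_sq_le {z : ℝ} (hz : |z| ≤ 1 / 2) : Real.exp (z - 2 * z ^ 2) ≤ 1 + z := by
  obtain ⟨h1, h2⟩ := abs_le.1 hz
  have h3 := (abs_le.1 (Real.abs_exp_sub_one_sub_id_le (hz.trans (by norm_num)))).2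
  have h4 : 1 + 2 * z ^ 2 ≤ Real.exp (2 * z ^ 2) := by linarith [Real.add_one_le_exp (2 * z ^ 2)]
  rw [Real.exp_sub, div_le_iff₀ (Real.exp_pos _)]
  have h5 : 0 ≤ z ^ 2 * (1 + 2 * z) := mul_nonneg (sq_nonneg z) (by linarith)
  nlinarith [mul_le_mul_of_nonneg_left h4 (by linarith : 0 ≤ 1 + z)]

/-! ### Exponential potential of the forecasting errors. -/

section Potential

variable {Y : Type*}

theorem oneHot_mem (y k : Y) : oneHot y k ∈ Set.Icc (0 : ℝ) 1 := by
  unfold oneHot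
  split_ifs <;> simp

variable [Fintype Y]

theorem sum_mul_oneHot (y : Y) (f : Y → ℝ) : ∑ k, f k * oneHot y k = f y := by
  classical
  simp [oneHot]

theorem sum_oneHot_mul (q : Y → ℝ) (k : Y) : ∑ y, q y * oneHot y k = q k := by
  classical
  simp [oneHot]

theorem forecast_mem (q : stdSimplex ℝ Y) (k : Y) : q.1 k ∈ Set.Icc (0 : ℝ) 1 :=
  ⟨q.2.1 k, q.2.2 ▸ Finset.single_le_sum (fun i _ => q.2.1 i) (Finset.mem_univ k)⟩

/-- The forecasting error in coordinate `k`, on the event `E`. -/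
noncomputable def eventError (E : Set (stdSimplex ℝ Y)) (y k : Y) (q : stdSimplex ℝ Y) : ℝ :=
  E.indicator (fun q => q.1 k - oneHot y k) q

theorem abs_eventError_le (E : Set (stdSimplex ℝ Y)) (y k : Y) (q : stdSimplex ℝ Y) :
    |eventError E y k q| ≤ E.indicator (fun _ => (1 : ℝ)) q := by
  unfold eventError
  by_cases hq : q ∈ E
  · simp only [Set.indicator_of_mem hq]
    obtain ⟨h1, h2⟩ := forecast_mem q k
    obtain ⟨h3, h4⟩ := oneHot_mem y k
    exact abs_le.2 ⟨by linarith, by linarith⟩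
  · simp [Set.indicator_of_notMem hq]

theorem abs_eventError_le_one (E : Set (stdSimplex ℝ Y)) (y k : Y) (q : stdSimplex ℝ Y) :
    |eventError E y k q| ≤ 1 :=
  (abs_eventError_le E y k q).trans
    (Set.indicator_le_self' (fun _ _ => zero_le_one) q)

/-- A forecast is unbiased for a state drawn from it; this is the hypothesis of the minimax
principle, for each summand of the loss. -/
theorem sum_mul_eventError (E : Set (stdSimplex ℝ Y)) (k : Y) (q : stdSimplex ℝ Y) :
    ∑ y, q.1 y * eventError E y k q = 0 := by
  unfold eventError
  by_cases hq : q ∈ E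
  · simp only [Set.indicator_of_mem hq, mul_sub, Finset.sum_sub_distrib, ← Finset.sum_mul,
      q.2.2, one_mul, sum_oneHot_mul, sub_self]
  · simp [Set.indicator_of_notMem hq]

/-- The cumulative forecasting error in coordinate `k` on the event `E`. -/
noncomputable def cumError {T : ℕ} (y : Fin T → Y) (π : Fin T → stdSimplex ℝ Y)
    (E : Set (stdSimplex ℝ Y)) (k : Y) : ℝ :=
  ∑ t, eventError E (y t) k (π t)

theorem condBias_eq {T : ℕ} (y : Fin T → Y) (π : Fin T → stdSimplex ℝ Y)
    (E : Set (stdSimplex ℝ Y)) : condBias y π E = 1 / (T : ℝ) * ∑ k, |cumError y π E k| := rfl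

theorem eventCount_eq_sum {T : ℕ} (π : Fin T → stdSimplex ℝ Y) (E : Set (stdSimplex ℝ Y)) :
    (eventCount π E : ℝ) = ∑ t, E.indicator (fun _ => (1 : ℝ)) (π t) := by
  classical
  unfold eventCount
  rw [Set.ncard_eq_toFinset_card']
  simp [Set.indicator_apply]

theorem eventCount_le {T : ℕ} (π : Fin T → stdSimplex ℝ Y) (E : Set (stdSimplex ℝ Y)) :
    eventCount π E ≤ T := by
  unfold eventCount
  simpa [Nat.card_eq_fintype_card] using Set.ncard_le_card {t | π t ∈ E}

theorem abs_cumError_le {T : ℕ} (y : Fin T → Y) (π : Fin T → stdSimplex ℝ Y)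
    (E : Set (stdSimplex ℝ Y)) (k : Y) : |cumError y π E k| ≤ T := by
  refine (Finset.abs_sum_le_sum_abs _ _).trans
    ((Finset.sum_le_sum fun t _ => abs_eventError_le_one E (y t) k (π t)).trans ?_)
  simp

/-- The exponential of the cumulative error at learning rate `η`, with a second-order
correction. -/
noncomputable def expError (η : ℝ) {T : ℕ} (y : Fin T → Y) (π : Fin T → stdSimplex ℝ Y)
    (E : Set (stdSimplex ℝ Y)) (k : Y) : ℝ :=
  Real.exp (η * cumError y π E k - 2 * η ^ 2 * eventCount π E)

/-- The correction absorbs the quadratic term of the exponential, leaving an increment linear in the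
new error. As errors lie in `[-1, 1]`, counting occurrences of `E` dominates summing squared errors.
-/
theorem expError_snoc_le {η : ℝ} (hη : |η| ≤ 1 / 2) {T : ℕ} (y : Fin (T + 1) → Y)
    (π : Fin T → stdSimplex ℝ Y) (q : stdSimplex ℝ Y) (E : Set (stdSimplex ℝ Y)) (k : Y) :
    expError η y (Fin.snoc (α := fun _ => stdSimplex ℝ Y) π q) E k ≤
      expError η (fun t => y t.castSucc) π E k +
        η * expError η (fun t => y t.castSucc) π E k * eventError E (y (Fin.last T)) k q := by
  set x := eventError E (y (Fin.last T)) k q with hx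
  set e := E.indicator (fun _ => (1 : ℝ)) q with he
  have hxe : x ^ 2 ≤ e := by
    have h1 := abs_eventError_le E (y (Fin.last T)) k q
    have h2 := abs_eventError_le_one E (y (Fin.last T)) k q
    rw [← hx] at h1 h2
    rw [← he] at h1
    rw [← sq_abs]
    nlinarith [abs_nonneg x]
  have hstep : expError η y (Fin.snoc (α := fun _ => stdSimplex ℝ Y) π q) E k =
      expError η (fun t => y t.castSucc) π E k * Real.exp (η * x - 2 * η ^ 2 * e) := by
    unfold expError
    rw [← Real.exp_add, eventCount_eq_sum, eventCount_eq_sum, cumError, cumError,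
      Fin.sum_univ_castSucc, Fin.sum_univ_castSucc]
    simp only [Fin.snoc_castSucc, Fin.snoc_last, ← hx, ← he]
    congr 1
    ring
  have hz : |η * x| ≤ 1 / 2 := by
    rw [abs_mul]
    calc |η| * |x| ≤ |η| * 1 :=
          mul_le_mul_of_nonneg_left (abs_eventError_le_one _ _ _ _) (abs_nonneg _)
      _ ≤ 1 / 2 := by linarith
  have hexp : Real.exp (η * x - 2 * η ^ 2 * e) ≤ 1 + η * x := by
    refine le_trans (Real.exp_le_exp.2 ?_) (exp_sub_two_mul_sq_le hz)
    nlinarith [mul_le_mul_of_nonneg_left hxe (sq_nonneg η)]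
  rw [hstep]
  calc _ ≤ expError η (fun t => y t.castSucc) π E k * (1 + η * x) :=
        mul_le_mul_of_nonneg_left hexp (Real.exp_pos _).le
    _ = _ := by ring

theorem bounded_expError (η : ℝ) {T : ℕ} (y : Fin T → Y) (E : Set (stdSimplex ℝ Y)) (k : Y) :
    ∃ B, ∀ π : Fin T → stdSimplex ℝ Y, |expError η y π E k| ≤ B := by
  refine ⟨Real.exp (|η| * T), fun π => ?_⟩
  unfold expError
  rw [abs_of_pos (Real.exp_pos _)]
  refine Real.exp_le_exp.2 ?_
  have h1 : η * cumError y π E k ≤ |η| * T := by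
    refine (le_abs_self _).trans ?_
    rw [abs_mul]
    exact mul_le_mul_of_nonneg_left (abs_cumError_le y π E k) (abs_nonneg _)
  have h2 : 0 ≤ 2 * η ^ 2 * (eventCount π E : ℝ) := by positivity
  linarith

/-- The sum of `expError` over all events, coordinates and learning rates. -/
noncomputable def potential {ι J : Type*} [Fintype ι] [Fintype J] (E : ι → Set (stdSimplex ℝ Y))
    (η : J → ℝ) {T : ℕ} (y : Fin T → Y) (π : Fin T → stdSimplex ℝ Y) : ℝ :=
  ∑ i, ∑ k, ∑ j, expError (η j) y π (E i) k

variable {ι J : Type*} [Fintype ι] [Fintype J] (E : ι → Set (stdSimplex ℝ Y)) (η : J → ℝ)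

theorem bounded_potential {T : ℕ} (y : Fin T → Y) :
    ∃ B, ∀ π : Fin T → stdSimplex ℝ Y, |potential E η y π| ≤ B :=
  bounded_sum _ fun i _ => bounded_sum _ fun k _ => bounded_sum _ fun j _ =>
    bounded_expError (η j) y (E i) k

theorem potential_nonneg {T : ℕ} (y : Fin T → Y) (π : Fin T → stdSimplex ℝ Y) :
    0 ≤ potential E η y π :=
  Finset.sum_nonneg fun _ _ => Finset.sum_nonneg fun _ _ => Finset.sum_nonneg fun _ _ =>
    (Real.exp_pos _).le

theorem expError_le_potential {T : ℕ} (y : Fin T → Y) (π : Fin T → stdSimplex ℝ Y) (i : ι) (k : Y)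
    (j : J) : expError (η j) y π (E i) k ≤ potential E η y π := by
  have h0 : ∀ i k j, 0 ≤ expError (η j) y π (E i) k := fun _ _ _ => (Real.exp_pos _).le
  calc _ ≤ ∑ j, expError (η j) y π (E i) k :=
        Finset.single_le_sum (f := fun j => expError (η j) y π (E i) k)
          (fun j _ => h0 i k j) (Finset.mem_univ j)
    _ ≤ ∑ k, ∑ j, expError (η j) y π (E i) k :=
        Finset.single_le_sum (f := fun k => ∑ j, expError (η j) y π (E i) k)
          (fun k _ => Finset.sum_nonneg fun j _ => h0 i k j) (Finset.mem_univ k)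
    _ ≤ _ := Finset.single_le_sum (f := fun i => ∑ k, ∑ j, expError (η j) y π (E i) k)
          (fun i _ => Finset.sum_nonneg fun k _ => Finset.sum_nonneg fun j _ => h0 i k j)
          (Finset.mem_univ i)

/-- The minimax principle is applied to the linearized increment. One distribution must serve every
next state, hence the quantifier over extensions `y'` after `μ`. -/
theorem exists_forecast_potential_le [Nonempty Y] {ε : ℝ} (hε : 0 < ε) (hη : ∀ j, |η j| ≤ 1 / 2)
    {T : ℕ} (y : Fin T → Y) (π : Fin T → stdSimplex ℝ Y) :
    ∃ μ : PMF (stdSimplex ℝ Y), ∀ y' : Fin (T + 1) → Y, (∀ t, y' t.castSucc = y t) →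
      expect μ (fun q => potential E η y' (Fin.snoc (α := fun _ => stdSimplex ℝ Y) π q)) ≤
        potential E η y π + ε := by
  let c : ι → Y → J → ℝ := fun i k j => η j * expError (η j) y π (E i) k
  let g : stdSimplex ℝ Y → Y → ℝ := fun q b =>
    ∑ i, ∑ k, ∑ j, c i k j * eventError (E i) b k q
  have hgb : ∀ b, ∃ B, ∀ q, |g q b| ≤ B := fun b =>
    bounded_sum _ fun i _ => bounded_sum _ fun k _ => bounded_sum _ fun j _ =>
      bounded_const_mul _ ⟨1, abs_eventError_le_one (E i) b k⟩
  have hg : ∀ q : stdSimplex ℝ Y, ∑ b, q.1 b * g q b ≤ 0 := fun q => by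
    refine le_of_eq ?_
    simp only [g, Finset.mul_sum]
    rw [Finset.sum_comm]
    refine Finset.sum_eq_zero fun i _ => ?_
    rw [Finset.sum_comm]
    refine Finset.sum_eq_zero fun k _ => ?_
    rw [Finset.sum_comm]
    refine Finset.sum_eq_zero fun j _ => ?_
    simp only [mul_left_comm _ (c i k j), ← Finset.mul_sum, sum_mul_eventError, mul_zero]
  obtain ⟨μ, hμ⟩ := exists_pmf_expect_le g hgb hg hε
  refine ⟨μ, fun y' hy' => ?_⟩
  obtain rfl : (fun t : Fin T => y' t.castSucc) = y := funext hy'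
  calc _ ≤ expect μ (fun q => potential E η (fun t => y' t.castSucc) π + g q (y' (Fin.last T))) := by
        refine expect_mono μ ?_ (bounded_add (bounded_const _) (hgb _)) fun q _ => ?_
        · obtain ⟨B, hB⟩ := bounded_potential E η y'
          exact ⟨B, fun q => hB _⟩
        · simp only [potential, g, ← Finset.sum_add_distrib]
          exact Finset.sum_le_sum fun i _ => Finset.sum_le_sum fun k _ =>
            Finset.sum_le_sum fun j _ => expError_snoc_le (hη j) y' π q (E i) k
    _ = potential E η (fun t => y' t.castSucc) π +
        expect μ (fun q => g q (y' (Fin.last T))) := by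
        rw [expect_add _ (bounded_const _) (hgb _), expect_const]
    _ ≤ _ := by linarith [hμ (y' (Fin.last T))]

theorem exists_forecaster_potential_le [Nonempty Y] {ε : ℝ} (hε : 0 < ε)
    (hη : ∀ j, |η j| ≤ 1 / 2) :
    ∃ F : Forecaster Y, ∀ (T : ℕ) (y : Fin T → Y),
      expect (forecastLaw F T y) (potential E η y) ≤
        Fintype.card ι * Fintype.card Y * Fintype.card J + T * ε := by
  choose F hF using fun (t : ℕ) (y : Fin t → Y) π =>
    exists_forecast_potential_le E η hε hη y π
  refine ⟨F, fun T => ?_⟩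
  induction T with
  | zero =>
    intro y
    simp [forecastLaw, expect_pure, potential, expError, cumError, eventCount_eq_sum, mul_assoc]
  | succ T ih =>
    intro y
    have hb := bounded_potential E η y
    rw [forecastLaw, expect_bind _ _ hb]
    calc _ ≤ expect (forecastLaw F T fun i => y i.castSucc)
          (fun π => potential E η (fun i => y i.castSucc) π + ε) := by
          refine expect_mono _ ?_ (bounded_add (bounded_potential E η _) (bounded_const ε)) ?_
          · obtain ⟨B, hB⟩ := hb
            exact ⟨B, fun π => abs_expect_le _ hB⟩
          · intro π _
            rw [expect_map _ _ hb]
            exact hF T (fun i => y i.castSucc) π y fun _ => rfl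
      _ = expect (forecastLaw F T fun i => y i.castSucc)
          (potential E η fun i => y i.castSucc) + ε := by
          rw [expect_add _ (bounded_potential E η _) (bounded_const ε), expect_const]
      _ ≤ _ := by
          push_cast
          linarith [ih fun i => y i.castSucc]

end Potential

/-- The learning rate suited to an event that occurs `n` times. -/
noncomputable def learningRate (l n : ℝ) : ℝ := √l / (2 * √l + √n)

theorem abs_learningRate_le {l : ℝ} (hl : 0 < l) (n : ℝ) : |learningRate l n| ≤ 1 / 2 := by
  have h1 := Real.sqrt_pos.2 hl
  have h2 := Real.sqrt_nonneg n
  unfold learningRate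
  rw [abs_of_nonneg (by positivity), div_le_iff₀ (by positivity)]
  linarith

/-- Dividing by the rate `η` gives `x ≤ L / η + 2 η n`. Here `L / η = L (2 + √n / √l)` and `2 η n ≤
2 √l √n`, which are balanced when `L` is of order `l`. -/
theorem le_of_learningRate_mul_le {l n x L : ℝ} (hl : 0 < l) (hn : 0 ≤ n) (hL : 0 ≤ L)
    (h : learningRate l n * x - 2 * learningRate l n ^ 2 * n ≤ L) :
    x ≤ (l + √(l * n)) * (2 * L / l + 2) := by
  rw [Real.sqrt_mul hl.le]
  unfold learningRate at h
  have ha := Real.sqrt_pos.2 hl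
  have hb := Real.sqrt_nonneg n
  have hla := Real.sq_sqrt hl.le
  have hnb := Real.sq_sqrt hn
  set a := √l
  set b := √n
  rw [← hla]
  rw [← hnb] at h
  have hd : 0 < 2 * a + b := by positivity
  have h1 : a * x ≤ L * (2 * a + b) + 2 * a ^ 2 * b := by
    have h2 : a * x = a / (2 * a + b) * x * (2 * a + b) := by field_simp
    have h3 : 2 * (a / (2 * a + b)) ^ 2 * b ^ 2 * (2 * a + b) ≤ 2 * a ^ 2 * b := by
      have h4 : 2 * (a / (2 * a + b)) ^ 2 * b ^ 2 * (2 * a + b) =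
          2 * a ^ 2 * b ^ 2 / (2 * a + b) := by field_simp
      rw [h4, div_le_iff₀ hd]
      have : 0 ≤ a ^ 3 * b := by positivity
      nlinarith
    rw [h2]
    nlinarith [mul_le_mul_of_nonneg_right h hd.le]
  have h5 : (a ^ 2 + a * b) * (2 * L / a ^ 2 + 2) =
      (2 * L * (a + b) + 2 * a ^ 2 * (a + b)) / a := by field_simp
  rw [h5, le_div_iff₀ ha]
  have : 0 ≤ L * b := by positivity
  have : 0 ≤ a ^ 3 := by positivity
  nlinarith

/-! ### Existence of unbiased forecasters. -/

section Unbiased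

variable {Y : Type*} [Fintype Y]

theorem biasRate_eq (m : ℕ) {T : ℕ} (π : Fin T → stdSimplex ℝ Y) (E : Set (stdSimplex ℝ Y)) :
    biasRate m π E = 1 / (T : ℝ) * ((Fintype.card Y : ℝ) *
      (Real.log (Fintype.card Y * m * T) +
        √(Real.log (Fintype.card Y * m * T) * eventCount π E))) := by
  unfold biasRate
  ring

theorem condBias_nonneg {T : ℕ} (y : Fin T → Y) (π : Fin T → stdSimplex ℝ Y)
    (E : Set (stdSimplex ℝ Y)) : 0 ≤ condBias y π E := by
  rw [condBias_eq]
  positivity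

variable [Nonempty Y]

theorem two_le_card_mul {m T : ℕ} (hm : 2 ≤ m) (hT : 0 < T) :
    (2 : ℝ) ≤ Fintype.card Y * m * T := by
  have h1 : 1 ≤ Fintype.card Y := Fintype.card_pos
  have : 1 * 2 * 1 ≤ Fintype.card Y * m * T := Nat.mul_le_mul (Nat.mul_le_mul h1 hm) hT
  exact_mod_cast this

theorem biasRate_pos {m T : ℕ} (hm : 2 ≤ m) (hT : 0 < T) (π : Fin T → stdSimplex ℝ Y)
    (E : Set (stdSimplex ℝ Y)) : 0 < biasRate m π E := by
  have h := Real.log_pos (lt_of_lt_of_le one_lt_two (two_le_card_mul (Y := Y) hm hT))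
  have hY : (0 : ℝ) < Fintype.card Y := Nat.cast_pos.2 Fintype.card_pos
  have hT' : (0 : ℝ) < T := Nat.cast_pos.2 hT
  rw [biasRate_eq]
  positivity

variable {ι : Type*} [Fintype ι]

theorem bounded_biasRatio {T : ℕ} (hT : 0 < T) (hι : 2 ≤ Fintype.card ι) (y : Fin T → Y)
    (E : ι → Set (stdSimplex ℝ Y)) : ∃ B, ∀ π : Fin T → stdSimplex ℝ Y,
      |⨆ i, condBias y π (E i) / biasRate (Fintype.card ι) π (E i)| ≤ B := by
  have : Nonempty ι := Fintype.card_pos_iff.1 (by omega)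
  set l := Real.log (Fintype.card Y * Fintype.card ι * T) with hl
  have hlpos : 0 < l := Real.log_pos (lt_of_lt_of_le one_lt_two (two_le_card_mul hι hT))
  have hY : (0 : ℝ) < Fintype.card Y := Nat.cast_pos.2 Fintype.card_pos
  have hT' : (0 : ℝ) < T := Nat.cast_pos.2 hT
  -- The bias is at most `|Y|` and the rate at least `|Y| l / T`.
  refine ⟨T / l, fun π => abs_le.2 ⟨?_, ?_⟩⟩
  · refine (neg_nonpos.2 (by positivity)).trans (Real.iSup_nonneg fun i => ?_)
    exact div_nonneg (condBias_nonneg _ _ _) (biasRate_pos hι hT _ _).le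
  · refine ciSup_le fun i => ?_
    rw [div_le_iff₀ (biasRate_pos hι hT _ _), condBias_eq, biasRate_eq, ← hl, mul_left_comm]
    refine mul_le_mul_of_nonneg_left ?_ (by positivity)
    calc ∑ k, |cumError y π (E i) k| ≤ ∑ _k : Y, (T : ℝ) :=
          Finset.sum_le_sum fun k _ => abs_cumError_le y π (E i) k
      _ = T / l * (Fintype.card Y * l) := by
          simp only [Finset.sum_const, Finset.card_univ, nsmul_eq_mul]
          field_simp
      _ ≤ _ := by
          refine mul_le_mul_of_nonneg_left (mul_le_mul_of_nonneg_left ?_ hY.le) (by positivity)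
          linarith [Real.sqrt_nonneg (l * eventCount π (E i))]

/-- The rate is tuned to the realized count, and its two signs bound the absolute value of the
error. -/
theorem biasRatio_le_of_expError_le {T : ℕ} (hT : 0 < T) (hι : 2 ≤ Fintype.card ι)
    (y : Fin T → Y) (E : Set (stdSimplex ℝ Y)) (π : Fin T → stdSimplex ℝ Y) {l Z : ℝ}
    (hl : l = Real.log (Fintype.card Y * Fintype.card ι * T)) (hZ : 1 ≤ Z)
    (h1 : ∀ k, expError (learningRate l (eventCount π E)) y π E k ≤ Z)
    (h2 : ∀ k, expError (-learningRate l (eventCount π E)) y π E k ≤ Z) :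
    condBias y π E / biasRate (Fintype.card ι) π E ≤ 2 * Real.log Z / l + 2 := by
  have hlpos : 0 < l :=
    hl ▸ Real.log_pos (lt_of_lt_of_le one_lt_two (two_le_card_mul hι hT))
  rw [div_le_iff₀ (biasRate_pos hι hT _ _), condBias_eq, biasRate_eq, ← hl, mul_left_comm]
  refine mul_le_mul_of_nonneg_left ?_ (by positivity)
  have hk : ∀ k, |cumError y π E k| ≤
      (l + √(l * eventCount π E)) * (2 * Real.log Z / l + 2) := fun k => by
    have hlog : ∀ η, expError η y π E k ≤ Z →
        η * cumError y π E k - 2 * η ^ 2 * eventCount π E ≤ Real.log Z := fun η h =>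
      (Real.le_log_iff_exp_le (by linarith)).2 h
    refine abs_le'.2 ⟨?_, ?_⟩ <;>
      refine le_of_learningRate_mul_le hlpos (Nat.cast_nonneg _) (Real.log_nonneg hZ) ?_
    · exact hlog _ (h1 k)
    · have := hlog _ (h2 k)
      rw [neg_sq] at this
      linarith
  calc _ ≤ ∑ _k : Y, (l + √(l * eventCount π E)) * (2 * Real.log Z / l + 2) :=
        Finset.sum_le_sum fun k _ => hk k
    _ = _ := by
        simp only [Finset.sum_const, Finset.card_univ, nsmul_eq_mul]
        ring

/-- The ratio is at most `2 log Z / l + 2` with `Z` one plus the potential. Since `Z` has mean at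
most `4M + 2 ≤ 5M ≤ M⁴`, concavity of `log` gives `2 · 4 + 2 = 10`. -/
theorem exists_isUnbiasedForecaster {T : ℕ} (hT : 0 < T) (hι : 2 ≤ Fintype.card ι)
    (E : ι → Set (stdSimplex ℝ Y)) : ∃ F : Forecaster Y, IsUnbiasedForecaster 10 F T E := by
  have : Nonempty ι := Fintype.card_pos_iff.1 (by omega)
  set M : ℝ := Fintype.card Y * Fintype.card ι * T with hM
  have hM2 : 2 ≤ M := two_le_card_mul hι hT
  have hT' : (1 : ℝ) ≤ T := by exact_mod_cast hT
  set l := Real.log M with hl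
  have hlpos : 0 < l := Real.log_pos (by linarith)
  -- The count is not known in advance, so the grid has one rate of each sign for every possible
  -- count `0, …, T`.
  let η : Fin (T + 1) × Bool → ℝ := fun j =>
    if j.2 then learningRate l j.1 else -learningRate l j.1
  have hη : ∀ j, |η j| ≤ 1 / 2 := fun j => by
    simp only [η]
    split_ifs
    · exact abs_learningRate_le hlpos _
    · rw [abs_neg]
      exact abs_learningRate_le hlpos _
  obtain ⟨F, hF⟩ := exists_forecaster_potential_le E η (ε := 1 / T) (by positivity) hη
  refine ⟨F, fun y => ?_⟩
  have hΦ : expect (forecastLaw F T y) (potential E η y) ≤ 4 * M + 1 := by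
    refine (hF T y).trans ?_
    have h1 : (T : ℝ) * (1 / T) = 1 := by field_simp
    rw [h1]
    simp only [Fintype.card_prod, Fintype.card_fin, Fintype.card_bool]
    push_cast
    have h2 : (0 : ℝ) ≤ Fintype.card ι * Fintype.card Y := by positivity
    nlinarith [mul_le_mul_of_nonneg_left hT' h2]
  have hpt : ∀ π ∈ (forecastLaw F T y).support,
      (⨆ i, condBias y π (E i) / biasRate (Fintype.card ι) π (E i)) ≤
        (2 + 2 / l * Real.log (5 * M) + 2 / l * (1 / (5 * M) - 1)) +
          2 / l * (1 / (5 * M)) * potential E η y π := fun π _ => by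
    have h0 := potential_nonneg E η y π
    set Z := 1 + potential E η y π with hZdef
    -- The tangent of `log` at `5M` replaces Jensen's inequality.
    have hlog : Real.log Z ≤ Real.log (5 * M) + Z / (5 * M) - 1 := by
      have := Real.log_le_sub_one_of_pos (x := Z / (5 * M)) (by positivity)
      rw [Real.log_div (by positivity) (by positivity)] at this
      linarith
    refine ciSup_le fun i => (biasRatio_le_of_expError_le (Z := Z) hT hι y (E i) π hl
      (by linarith) (fun k => ?_) (fun k => ?_)).trans ?_
    · have := expError_le_potential E η y π i k
        (⟨eventCount π (E i), Nat.lt_succ_of_le (eventCount_le π (E i))⟩, true)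
      simp only [η, if_true] at this
      linarith
    · have := expError_le_potential E η y π i k
        (⟨eventCount π (E i), Nat.lt_succ_of_le (eventCount_le π (E i))⟩, false)
      simp only [η, Bool.false_eq_true, if_false] at this
      linarith
    · have := mul_le_mul_of_nonneg_left hlog (by positivity : 0 ≤ 2 / l)
      rw [hZdef] at this ⊢
      calc _ = 2 / l * Real.log (1 + potential E η y π) + 2 := by ring
        _ ≤ 2 / l * (Real.log (5 * M) + (1 + potential E η y π) / (5 * M) - 1) + 2 := by
          linarith
        _ = (2 + 2 / l * Real.log (5 * M) + 2 / l * (1 / (5 * M) - 1)) +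
          2 / l * (1 / (5 * M)) * potential E η y π := by ring
  have hb := bounded_potential E η y
  refine (expect_mono _ (bounded_biasRatio hT hι y E)
    (bounded_add (bounded_const _) (bounded_const_mul _ hb)) hpt).trans ?_
  rw [expect_add _ (bounded_const _) (bounded_const_mul _ hb), expect_const, expect_const_mul]
  have hlog5 : Real.log (5 * M) ≤ 4 * l := by
    rw [hl, ← Real.log_rpow (by positivity)]
    refine Real.log_le_log (by positivity) ?_
    norm_cast
    nlinarith [pow_le_pow_left₀ (by norm_num) hM2 3]
  have h1 : 2 / l * (1 / (5 * M)) * expect (forecastLaw F T y) (potential E η y) ≤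
      2 / l * (1 / (5 * M)) * (4 * M + 1) := mul_le_mul_of_nonneg_left hΦ (by positivity)
  have h2 : 1 / (5 * M) * (4 * M + 2) ≤ 1 := by
    rw [one_div_mul_eq_div, div_le_one (by positivity)]
    linarith
  have h3 := mul_le_mul_of_nonneg_left h2 (by positivity : 0 ≤ 2 / l)
  have h4 := mul_le_mul_of_nonneg_left hlog5 (by positivity : 0 ≤ 2 / l)
  have h5 : 2 / l * (4 * l) = 8 := by field_simp; norm_num
  nlinarith

end Unbiased

theorem abs_inv_mul_sum_le {T : ℕ} {f : Fin T → ℝ} {B : ℝ} (hB : 0 ≤ B) (hf : ∀ t, |f t| ≤ B) :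
    |1 / (T : ℝ) * ∑ t, f t| ≤ B := by
  rw [abs_mul, abs_of_nonneg (by positivity : (0 : ℝ) ≤ 1 / T)]
  have h : |∑ t, f t| ≤ T * B :=
    (Finset.abs_sum_le_sum_abs _ _).trans ((Finset.sum_le_sum fun t _ => hf t).trans (by simp))
  rw [one_div_mul_eq_div]
  exact div_le_of_le_mul₀ (Nat.cast_nonneg T) hB (by linarith)

/-! ### The Agent's regrets and the utility gap. -/

section Agent

variable {P A Y : Type*} (G : Game P A Y)

theorem Game.abs_V_le (a : A) (p : P) (y : Y) : |G.V a p y| ≤ 1 := abs_le.2 (G.V_mem a p y)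

theorem Game.abs_U_le (a : A) (p : P) (y : Y) : |G.U a p y| ≤ 1 := abs_le.2 (G.U_mem a p y)

theorem Game.abs_V_sub_V_le (a b : A) (p q : P) (y : Y) : |G.V a p y - G.V b q y| ≤ 2 :=
  (abs_sub _ _).trans (by linarith [G.abs_V_le a p y, G.abs_V_le b q y])

theorem Game.abs_U_sub_U_le (a b : A) (p q : P) (y : Y) : |G.U a p y - G.U b q y| ≤ 2 :=
  (abs_sub _ _).trans (by linarith [G.abs_U_le a p y, G.abs_U_le b q y])

theorem Game.abs_sum_U_le {T : ℕ} (y : Fin T → Y) (p : Fin T → P) (a : Fin T → A) :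
    |∑ t, G.U (a t) (p t) (y t)| ≤ T :=
  (Finset.abs_sum_le_sum_abs _ _).trans
    ((Finset.sum_le_sum fun t _ => G.abs_U_le _ _ _).trans (by simp))

/-- Insert the utility of the actual play between the two modifications: one difference is the swap
regret, the other the negative regret. -/
theorem Game.uGap_le [Nonempty A] {T : ℕ} (hT : 0 < T) (y : Fin T → Y) (p : Fin T → P)
    (r a : Fin T → A) :
    G.uGap y p r a ≤
      (⨆ h : P × A × A → A,
        (1 / (T : ℝ)) * ∑ t, (G.U (h (p t, r t, a t)) (p t) (y t) - G.U (a t) (p t) (y t))) +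
      1 / (T : ℝ) * ((∑ t, G.U (a t) (p t) (y t)) -
        ⨆ h : P × A → A, ∑ t, G.U (h (p t, r t)) (p t) (y t)) := by
  have hT' : (0 : ℝ) < T := Nat.cast_pos.2 hT
  set S := ⨆ h : P × A × A → A,
    (1 / (T : ℝ)) * ∑ t, (G.U (h (p t, r t, a t)) (p t) (y t) - G.U (a t) (p t) (y t)) with hS
  have hbdd : BddAbove (Set.range fun h : P × A × A → A =>
      (1 / (T : ℝ)) * ∑ t, (G.U (h (p t, r t, a t)) (p t) (y t) - G.U (a t) (p t) (y t))) := by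
    refine ⟨2, ?_⟩
    rintro _ ⟨h, rfl⟩
    exact (abs_le.1 (abs_inv_mul_sum_le zero_le_two fun t => G.abs_U_sub_U_le _ _ _ _ _)).2
  have key : (⨆ h : P × A × A → A, ⨅ h' : P × A → A,
      ∑ t, (G.U (h (p t, r t, a t)) (p t) (y t) - G.U (h' (p t, r t)) (p t) (y t))) ≤
      T * S + ((∑ t, G.U (a t) (p t) (y t)) -
        ⨆ h : P × A → A, ∑ t, G.U (h (p t, r t)) (p t) (y t)) := by
    refine ciSup_le fun h => ?_
    have hSh : (∑ t, G.U (h (p t, r t, a t)) (p t) (y t)) - ∑ t, G.U (a t) (p t) (y t) ≤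
        T * S := by
      have := le_ciSup hbdd h
      rw [← hS, one_div_mul_eq_div, div_le_iff₀ hT', Finset.sum_sub_distrib] at this
      linarith
    have hbelow : BddBelow (Set.range fun h' : P × A → A =>
        ∑ t, (G.U (h (p t, r t, a t)) (p t) (y t) - G.U (h' (p t, r t)) (p t) (y t))) := by
      refine ⟨-(T + T), ?_⟩
      rintro _ ⟨h', rfl⟩
      simp only [Finset.sum_sub_distrib]
      linarith [(abs_le.1 (G.abs_sum_U_le y p fun t => h (p t, r t, a t))).1,
        (abs_le.1 (G.abs_sum_U_le y p fun t => h' (p t, r t))).2]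
    have hsup : (⨆ h' : P × A → A, ∑ t, G.U (h' (p t, r t)) (p t) (y t)) ≤
        (∑ t, G.U (h (p t, r t, a t)) (p t) (y t)) - ⨅ h' : P × A → A,
          ∑ t, (G.U (h (p t, r t, a t)) (p t) (y t) - G.U (h' (p t, r t)) (p t) (y t)) := by
      refine ciSup_le fun h' => ?_
      have := ciInf_le hbelow h'
      simp only [Finset.sum_sub_distrib] at this ⊢
      linarith
    linarith
  unfold Game.uGap
  calc _ ≤ 1 / (T : ℝ) * (T * S + ((∑ t, G.U (a t) (p t) (y t)) -
        ⨆ h : P × A → A, ∑ t, G.U (h (p t, r t)) (p t) (y t))) :=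
        mul_le_mul_of_nonneg_left key (by positivity)
    _ = _ := by
        rw [mul_add, ← mul_assoc, one_div_mul_cancel hT'.ne', one_mul]

theorem Game.expect_uGap_le [Finite A] [Nonempty A] {T : ℕ} (hT : 0 < T) (y : Fin T → Y)
    (p : Fin T → P) (r : Fin T → A) (μ : PMF (Fin T → A)) :
    expect μ (G.uGap y p r) ≤ G.swapReg y p r μ + G.negReg y p r μ := by
  unfold Game.swapReg Game.negReg
  rw [← expect_const_mul, ← expect_add _ (bounded_of_finite _) (bounded_of_finite _)]
  exact expect_mono _ (bounded_of_finite _) (bounded_of_finite _) fun a _ => G.uGap_le hT y p r a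

/-- If the Agent's play is aligned with the play of `r` up to the utility gap, then in expectation
it is aligned up to his regrets. -/
theorem Game.expect_le_of_alignment [Finite A] [Nonempty A] {T : ℕ} (hT : 0 < T) (y : Fin T → Y)
    (p : Fin T → P) (r : Fin T → A) (μ : PMF (Fin T → A)) {f : (Fin T → A) → ℝ}
    {M₁ M₂ εswap εneg : ℝ} (hM : 0 ≤ M₁) (hs : G.swapReg y p r μ ≤ εswap)
    (hn : G.negReg y p r μ ≤ εneg) (hf : ∀ a ∈ μ.support, f a ≤ M₁ * G.uGap y p r a + M₂) :
    expect μ f ≤ M₁ * (εswap + εneg) + M₂ := by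
  refine (expect_mono _ (bounded_of_finite _) (bounded_of_finite _) hf).trans ?_
  rw [expect_add _ (bounded_of_finite _) (bounded_const _), expect_const, expect_const_mul]
  have := mul_le_mul_of_nonneg_left ((G.expect_uGap_le hT y p r μ).trans (add_le_add hs hn)) hM
  linarith

end Agent

/-! ### From conditional bias to payoff error. -/

section Bias

variable {Y : Type*} [Fintype Y] {κ : Type*} [Fintype κ]

theorem sum_eventCount_fibers {T : ℕ} (π : Fin T → stdSimplex ℝ Y) (c : stdSimplex ℝ Y → κ) :
    ∑ j, (eventCount π {q | c q = j} : ℝ) = T := by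
  classical
  simp only [eventCount_eq_sum]
  rw [Finset.sum_comm]
  simp [Set.indicator_apply]

/-- Cauchy–Schwarz, as the fiber counts add up to `T`. The free bound `n` lets partitions of
different sizes share one estimate. -/
theorem sum_biasRate_fibers_le {T : ℕ} (hT : 0 < T) (m : ℕ) (π : Fin T → stdSimplex ℝ Y)
    (c : stdSimplex ℝ Y → κ) {l n : ℝ} (hl : l = Real.log (Fintype.card Y * m * T))
    (hl0 : 0 ≤ l) (hn : Fintype.card κ ≤ n) :
    ∑ j, biasRate m π {q | c q = j} ≤ Fintype.card Y * (l * n / T + √(l * n / T)) := by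
  have hT' : (0 : ℝ) < T := Nat.cast_pos.2 hT
  have hsqrt : ∑ j, √(l * eventCount π {q | c q = j}) ≤ T * √(l * n / T) := by
    have h1 : (∑ j, √(l * eventCount π {q | c q = j})) ^ 2 ≤ n * (l * T) := by
      refine sq_sum_le_card_mul_sum_sq.trans ?_
      have h2 : ∑ j, √(l * eventCount π {q | c q = j}) ^ 2 = l * T := by
        rw [← sum_eventCount_fibers π c, Finset.mul_sum]
        exact Finset.sum_congr rfl fun j _ => Real.sq_sqrt (by positivity)
      rw [h2]
      exact mul_le_mul_of_nonneg_right (by simpa using hn) (by positivity)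
    refine (Real.le_sqrt_of_sq_le h1).trans (le_of_eq ?_)
    have h3 : n * (l * T) = T ^ 2 * (l * n / T) := by field_simp
    rw [h3, Real.sqrt_mul (by positivity), Real.sqrt_sq hT'.le]
  simp only [biasRate_eq, ← hl]
  rw [← Finset.mul_sum, ← Finset.mul_sum, Finset.sum_add_distrib, Finset.sum_const,
    Finset.card_univ, nsmul_eq_mul]
  calc _ ≤ 1 / (T : ℝ) * (Fintype.card Y * (n * l + T * √(l * n / T))) := by gcongr
    _ = _ := by field_simp

/-- On a fiber of `c` the payoff vector is constant, so the payoff error is a linear functional,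
with coefficients in `[-1, 1]`, of the cumulative forecasting error. -/
theorem abs_sum_mul_forecast_sub_le {T : ℕ} (y : Fin T → Y) (π : Fin T → stdSimplex ℝ Y)
    (c : stdSimplex ℝ Y → κ) (w : κ → Y → ℝ) (hw : ∀ j k, |w j k| ≤ 1) :
    |1 / (T : ℝ) * ∑ t, (∑ k, (π t).1 k * w (c (π t)) k - w (c (π t)) (y t))| ≤
      ∑ j, condBias y π {q | c q = j} := by
  classical
  have h1 : ∀ t, ∑ k, (π t).1 k * w (c (π t)) k - w (c (π t)) (y t) =
      ∑ j, ∑ k, w j k * eventError {q | c q = j} (y t) k (π t) := fun t => by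
    rw [Finset.sum_eq_single (c (π t))]
    · rw [← sum_mul_oneHot (y t) (w (c (π t))), ← Finset.sum_sub_distrib]
      refine Finset.sum_congr rfl fun k _ => ?_
      rw [eventError, Set.indicator_of_mem (by rfl)]
      ring
    · intro j _ hj
      refine Finset.sum_eq_zero fun k _ => ?_
      rw [eventError, Set.indicator_of_notMem (s := {q | c q = j}) fun h => hj (Eq.symm h),
        mul_zero]
    · exact fun h => absurd (Finset.mem_univ _) h
  have h2 : ∑ t, (∑ k, (π t).1 k * w (c (π t)) k - w (c (π t)) (y t)) =
      ∑ j, ∑ k, w j k * cumError y π {q | c q = j} k := by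
    simp only [h1, cumError, Finset.mul_sum]
    rw [Finset.sum_comm]
    exact Finset.sum_congr rfl fun j _ => Finset.sum_comm
  rw [h2, abs_mul, abs_of_nonneg (by positivity : (0 : ℝ) ≤ 1 / T)]
  simp only [condBias_eq, ← Finset.mul_sum]
  refine mul_le_mul_of_nonneg_left ?_ (by positivity)
  refine (Finset.abs_sum_le_sum_abs _ _).trans (Finset.sum_le_sum fun j _ => ?_)
  refine (Finset.abs_sum_le_sum_abs _ _).trans (Finset.sum_le_sum fun k _ => ?_)
  rw [abs_mul]
  exact mul_le_of_le_one_left (abs_nonneg _) (hw j k)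

end Bias

/-! ### The policy regret bound. -/

section Regret

variable {P A Y : Type*} [Fintype Y] (G : Game P A Y) {aStar : P → stdSimplex ℝ Y → A}
  {pStar : stdSimplex ℝ Y → P}

theorem Game.bounded_regretGiven (aStar : P → stdSimplex ℝ Y → A) (ψ : stdSimplex ℝ Y → P)
    (L : AgentAlg P A Y) {T : ℕ} (y : Fin T → Y) :
    ∃ B, ∀ π, |G.regretGiven aStar ψ L y π| ≤ B := by
  refine ⟨2, fun π => ?_⟩
  have h : ∀ p₀, |expect (playLaw L aStar y π fun _ => p₀) fun a₀ =>
      expect (playLaw L aStar y π ψ) fun a =>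
        (1 / (T : ℝ)) * ∑ t, (G.V (a₀ t) p₀ (y t) - G.V (a t) (ψ (π t)) (y t))| ≤ 2 := fun p₀ =>
    abs_expect_le _ fun a₀ => abs_expect_le _ fun a =>
      abs_inv_mul_sum_le zero_le_two fun t => G.abs_V_sub_V_le _ _ _ _ _
  unfold Game.regretGiven Game.maxBenchmark
  obtain ⟨p₀, hp₀⟩ := G.P₀_nonempty
  refine abs_le.2 ⟨?_, ?_⟩
  · exact Finset.le_sup'_of_le _ hp₀ (abs_le.1 (h p₀)).1
  · exact Finset.sup'_le _ _ fun p _ => (abs_le.1 (h p)).2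

/-- The regret that the recommendations would have if the Agent followed them. -/
noncomputable def Game.recRegret (G : Game P A Y) (aStar : P → stdSimplex ℝ Y → A)
    (ψ : stdSimplex ℝ Y → P) {T : ℕ} (y : Fin T → Y) (π : Fin T → stdSimplex ℝ Y) (p₀ : P) : ℝ :=
  1 / (T : ℝ) * ∑ t, (G.V (aStar p₀ (π t)) p₀ (y t) -
    G.V (aStar (ψ (π t)) (π t)) (ψ (π t)) (y t))

theorem Game.regretGiven_le [Finite A] [Nonempty A] {ψ : stdSimplex ℝ Y → P}
    {L : AgentAlg P A Y} {T : ℕ} (hT : 0 < T) {y : Fin T → Y} {π : Fin T → stdSimplex ℝ Y}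
    {εswap εneg M₁ M₂ R : ℝ} (hM : 0 ≤ M₁)
    (hs : G.NoContextualSwapRegret aStar ψ L y π εswap)
    (ha : G.Alignment aStar ψ L y π M₁ M₂)
    (hn : G.NoNegativeCrossSwapRegret aStar ψ L y π εneg)
    (hR : ∀ p₀ ∈ G.P₀, G.recRegret aStar ψ y π p₀ ≤ R) :
    G.regretGiven aStar ψ L y π ≤ R + 2 * (M₁ * (εswap + εneg) + M₂) := by
  unfold Game.regretGiven Game.maxBenchmark
  refine Finset.sup'_le _ _ fun p₀ hp₀ => ?_
  have h1 := G.expect_le_of_alignment hT y _ _ _ hM hs.1 hn.1 ha.1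
  have h2 := G.expect_le_of_alignment hT y _ _ _ hM (hs.2 p₀ hp₀) (hn.2 p₀ hp₀) (ha.2 p₀ hp₀)
  -- Both recommended plays are inserted between the two actual plays.
  have hsplit : ∀ a₀ a : Fin T → A,
      (1 / (T : ℝ)) * ∑ t, (G.V (a₀ t) p₀ (y t) - G.V (a t) (ψ (π t)) (y t)) =
      ((1 / (T : ℝ)) * ∑ t, (G.V (recs aStar ψ π t) (ψ (π t)) (y t) -
          G.V (a t) (ψ (π t)) (y t))) +
        (1 / (T : ℝ) * ∑ t, (G.V (a₀ t) p₀ (y t) -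
          G.V (recs aStar (fun _ => p₀) π t) p₀ (y t)) +
        G.recRegret aStar ψ y π p₀) := fun a₀ a => by
    simp only [Game.recRegret, recs, ← mul_add, ← Finset.sum_add_distrib]
    congr 1
    exact Finset.sum_congr rfl fun t _ => by ring
  simp only [hsplit]
  simp only [expect_add _ (bounded_of_finite _) (bounded_const _), expect_const]
  rw [expect_add _ (bounded_const _) (bounded_of_finite _), expect_const,
    expect_add _ (bounded_of_finite _) (bounded_const _), expect_const]
  linarith [hR p₀ hp₀]

variable [Fintype A]

/-- Each of the two payoffs is moved from states to forecasts at the cost of its bias sum; under the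
forecasts `pStar` does at least as well as `p₀` in every round. -/
theorem Game.recRegret_le_condBias (hp : G.IsOptimalPolicy aStar pStar) {T : ℕ}
    (y : Fin T → Y) (π : Fin T → stdSimplex ℝ Y) {p₀ : P} (hp₀ : p₀ ∈ G.P₀) :
    G.recRegret aStar pStar y π p₀ ≤
      ∑ a, condBias y π {q | aStar p₀ q = a} +
      ∑ i : G.P₀ × A, condBias y π
        {q | ((⟨pStar q, (hp q).1⟩ : G.P₀), aStar (pStar q) q) = i} := by
  have h1 := (abs_le.1 (abs_sum_mul_forecast_sub_le y π (aStar p₀) (fun a k => G.V a p₀ k)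
    fun _ _ => G.abs_V_le _ _ _)).1
  have h2 := (abs_le.1 (abs_sum_mul_forecast_sub_le y π
    (fun q => ((⟨pStar q, (hp q).1⟩ : G.P₀), aStar (pStar q) q))
    (fun i k => G.V i.2 i.1 k) fun _ _ => G.abs_V_le _ _ _)).2
  have h3 : 1 / (T : ℝ) * ∑ t, (G.expV (aStar p₀ (π t)) p₀ (π t) -
      G.expV (aStar (pStar (π t)) (π t)) (pStar (π t)) (π t)) ≤ 0 :=
    mul_nonpos_of_nonneg_of_nonpos (by positivity)
      (Finset.sum_nonpos fun t _ => sub_nonpos.2 ((hp (π t)).2 p₀ hp₀))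
  simp only [Game.recRegret, Game.expV, Finset.sum_sub_distrib, mul_sub] at h1 h2 h3 ⊢
  linarith

theorem Game.recRegret_le_biasRatio [Nonempty A] [Nonempty Y]
    (hp : G.IsOptimalPolicy aStar pStar) {T : ℕ} (hT : 0 < T)
    (y : Fin T → Y) (π : Fin T → stdSimplex ℝ Y) {p₀ : P} (hp₀ : p₀ ∈ G.P₀) {m : ℕ} (hm : 2 ≤ m)
    {l n R : ℝ} (hl : l = Real.log (Fintype.card Y * m * T)) (hn : n = G.P₀.card * Fintype.card A)
    (hR0 : 0 ≤ R)
    (hR : ∀ i, condBias y π (G.events aStar pStar i) / biasRate m π (G.events aStar pStar i) ≤ R) :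
    G.recRegret aStar pStar y π p₀ ≤
      2 * (Fintype.card Y * (l * n / T + √(l * n / T))) * R := by
  have hl0 : 0 ≤ l :=
    hl ▸ (Real.log_pos (lt_of_lt_of_le one_lt_two (two_le_card_mul hm hT))).le
  have hR' : ∀ i, condBias y π (G.events aStar pStar i) ≤
      R * biasRate m π (G.events aStar pStar i) := fun i =>
    (div_le_iff₀ (biasRate_pos hm hT _ _)).1 (hR i)
  have hcard : (1 : ℝ) ≤ G.P₀.card := by exact_mod_cast G.P₀_nonempty.card_pos
  have h1 := sum_biasRate_fibers_le hT m π (aStar p₀) (n := n) hl hl0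
    (by rw [hn]; exact le_mul_of_one_le_left (Nat.cast_nonneg _) hcard)
  have h2 := sum_biasRate_fibers_le hT m π
    (fun q => ((⟨pStar q, (hp q).1⟩ : G.P₀), aStar (pStar q) q)) (n := n) hl hl0
    (by rw [hn, Fintype.card_prod, Fintype.card_coe, Nat.cast_mul])
  have h3 : ∑ a, condBias y π {q | aStar p₀ q = a} ≤
      R * ∑ a, biasRate m π {q | aStar p₀ q = a} := by
    rw [Finset.mul_sum]
    exact Finset.sum_le_sum fun a _ => hR' (Sum.inl (⟨p₀, hp₀⟩, a))
  have h4 : ∑ i : G.P₀ × A, condBias y π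
        {q | ((⟨pStar q, (hp q).1⟩ : G.P₀), aStar (pStar q) q) = i} ≤
      R * ∑ i : G.P₀ × A, biasRate m π
        {q | ((⟨pStar q, (hp q).1⟩ : G.P₀), aStar (pStar q) q) = i} := by
    rw [Finset.mul_sum]
    refine Finset.sum_le_sum fun i _ => ?_
    -- Once `pStar q` equals the policy in `i`, responses to either coincide.
    have hset : {q | ((⟨pStar q, (hp q).1⟩ : G.P₀), aStar (pStar q) q) = i} =
        G.events aStar pStar (Sum.inr i) := by
      ext q
      obtain ⟨⟨p, hpP⟩, a⟩ := i
      simp only [Game.events, Sum.elim_inr, Game.eventsMech, Set.mem_ofPred_eq, Prod.mk.injEq,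
        Subtype.mk.injEq]
      constructor <;> rintro ⟨rfl, h⟩ <;> exact ⟨rfl, h⟩
    rw [hset]
    exact hR' _
  have h5 := G.recRegret_le_condBias hp y π hp₀
  have h6 := mul_le_mul_of_nonneg_left (add_le_add h1 h2) hR0
  linarith

theorem Game.policyRegret_le [Nonempty A] [Nonempty Y]
    (hp : G.IsOptimalPolicy aStar pStar) {T : ℕ} (hT : 0 < T) {F : Forecaster Y} {K : ℝ}
    (hK : 0 ≤ K) (hF : IsUnbiasedForecaster K F T (G.events aStar pStar)) (L : AgentAlg P A Y)
    (y : Fin T → Y) {εswap εneg M₁ M₂ : ℝ} (hM : 0 ≤ M₁)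
    (hass : ∀ π ∈ (forecastLaw F T y).support,
      G.NoContextualSwapRegret aStar pStar L y π εswap ∧
      G.Alignment aStar pStar L y π M₁ M₂ ∧
      G.NoNegativeCrossSwapRegret aStar pStar L y π εneg) :
    G.policyRegret aStar F pStar L y ≤
      (4 * K + 2) * (Fintype.card Y * √(G.P₀.card * Fintype.card A / T) *
        √(Real.log (2 * Fintype.card Y * G.P₀.card * Fintype.card A * T))) +
      2 * (M₁ * (εswap + εneg) + M₂) := by
  set D := 2 * (M₁ * (εswap + εneg) + M₂)
  set n : ℝ := G.P₀.card * Fintype.card A with hn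
  set m := Fintype.card ((G.P₀ × A) ⊕ (G.P₀ × A)) with hm
  have hmn : m = 2 * (G.P₀.card * Fintype.card A) := by
    rw [hm, Fintype.card_sum, Fintype.card_prod, Fintype.card_coe, two_mul]
  have hm2 : 2 ≤ m := by
    have : 0 < G.P₀.card * Fintype.card A := Nat.mul_pos G.P₀_nonempty.card_pos Fintype.card_pos
    omega
  set l := Real.log (Fintype.card Y * m * T) with hl
  have hl0 : 0 ≤ l := (Real.log_pos (lt_of_lt_of_le one_lt_two (two_le_card_mul hm2 hT))).le
  have hlog : Real.log (2 * Fintype.card Y * G.P₀.card * Fintype.card A * T) = l := by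
    rw [hl, hmn]
    push_cast
    congr 1
    ring
  have hY : (1 : ℝ) ≤ Fintype.card Y := by exact_mod_cast Fintype.card_pos (α := Y)
  set s := l * n / T with hs
  have hsqrt : √(n / T) * √l = √s := by
    rw [← Real.sqrt_mul (by positivity)]
    congr 1
    ring
  rw [hlog, mul_assoc (Fintype.card Y : ℝ), hsqrt]
  have hb := G.bounded_regretGiven aStar pStar L y
  unfold Game.policyRegret
  -- For `s ≤ 1` the linear term `s` is absorbed in `√s`, giving the factor `4K`. For `s > 1` the
  -- trivial bound `2` on the regret of the recommendations suffices.
  rcases le_or_gt s 1 with hs1 | hs1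
  · have hs0 : 0 ≤ s := by positivity
    have hss : s ≤ √s := Real.le_sqrt_of_sq_le (by nlinarith)
    set ratio := fun π : Fin T → stdSimplex ℝ Y =>
      ⨆ i, condBias y π (G.events aStar pStar i) / biasRate m π (G.events aStar pStar i)
    have hrb : ∃ B, ∀ π, |ratio π| ≤ B := bounded_biasRatio hT hm2 y _
    have hpt : ∀ π ∈ (forecastLaw F T y).support, G.regretGiven aStar pStar L y π ≤
        2 * (Fintype.card Y * (s + √s)) * ratio π + D := fun π hπ => by
      obtain ⟨h1, h2, h3⟩ := hass π hπ
      refine G.regretGiven_le hT hM h1 h2 h3 fun p₀ hp₀ =>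
        G.recRegret_le_biasRatio hp hT y π hp₀ hm2 hl hn ?_ fun i => ?_
      · exact Real.iSup_nonneg fun i =>
          div_nonneg (condBias_nonneg _ _ _) (biasRate_pos hm2 hT _ _).le
      · exact le_ciSup (f := fun i => condBias y π (G.events aStar pStar i) /
          biasRate m π (G.events aStar pStar i)) (Set.finite_range _).bddAbove i
    refine (expect_mono _ hb (bounded_add (bounded_const_mul _ hrb) (bounded_const D)) hpt).trans ?_
    rw [expect_add _ (bounded_const_mul _ hrb) (bounded_const D), expect_const_mul, expect_const]
    have hr : expect (forecastLaw F T y) ratio ≤ K := hF y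
    have hc : 2 * (Fintype.card Y * (s + √s)) ≤ 4 * (Fintype.card Y * √s) := by
      nlinarith
    have hc0 : 0 ≤ 2 * (Fintype.card Y * (s + √s)) := by positivity
    have hc1 : 0 ≤ Fintype.card Y * √s := by positivity
    nlinarith [mul_le_mul_of_nonneg_left hr hc0, mul_le_mul_of_nonneg_right hc hK]
  · have hpt : ∀ π ∈ (forecastLaw F T y).support,
        G.regretGiven aStar pStar L y π ≤ 2 + D := fun π hπ => by
      obtain ⟨h1, h2, h3⟩ := hass π hπ
      exact G.regretGiven_le hT hM h1 h2 h3 fun p₀ _ =>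
        (abs_le.1 (abs_inv_mul_sum_le zero_le_two fun t => G.abs_V_sub_V_le _ _ _ _ _)).2
    refine (expect_mono _ hb (bounded_const _) hpt).trans ?_
    rw [expect_const]
    have h1 : 1 ≤ √s := Real.one_le_sqrt.2 hs1.le
    have h2 : 1 ≤ Fintype.card Y * √s := one_le_mul_of_one_le_of_one_le hY h1
    nlinarith [mul_nonneg hK (zero_le_one.trans h2)]

end Regret

end PrincipalAgent

theorem theorem5 :
    ∃ K₀ : ℝ, 0 < K₀ ∧ ∀ K : ℝ, K₀ ≤ K → ∃ C : ℝ, 0 < C ∧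
      ∀ (P A Y : Type*) [Fintype A] [Nonempty A] [Fintype Y] [Nonempty Y]
        (G : Game P A Y) (aStar : P → stdSimplex ℝ Y → A) (pStar : stdSimplex ℝ Y → P),
        G.IsBestResponse aStar → G.IsOptimalPolicy aStar pStar →
        ∀ T : ℕ, 0 < T →
          (∃ F : Forecaster Y, IsUnbiasedForecaster K F T (G.events aStar pStar)) ∧
          ∀ F : Forecaster Y, IsUnbiasedForecaster K F T (G.events aStar pStar) →
            ∀ (L : AgentAlg P A Y) (y : Fin T → Y) (εswap εneg M₁ M₂ : ℝ), 0 ≤ M₁ →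
              (∀ π ∈ (forecastLaw F T y).support,
                G.NoContextualSwapRegret aStar pStar L y π εswap ∧
                G.Alignment aStar pStar L y π M₁ M₂ ∧
                G.NoNegativeCrossSwapRegret aStar pStar L y π εneg) →
              G.policyRegret aStar F pStar L y ≤
                C * (Fintype.card Y * √(G.P₀.card * Fintype.card A / T) *
                  √(Real.log (2 * Fintype.card Y * G.P₀.card * Fintype.card A * T))) +
                2 * (M₁ * (εswap + εneg) + M₂) := by
  -- `10` is the constant of `exists_isUnbiasedForecaster`; `4 * K + 2` covers both cases of
  -- `Game.policyRegret_le`.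
  refine ⟨10, by norm_num, fun K hK => ⟨4 * K + 2, by linarith, ?_⟩⟩
  intro P A Y _ _ _ _ G aStar pStar _ hp T hT
  refine ⟨?_, fun F hF L y εswap εneg M₁ M₂ hM hass =>
    G.policyRegret_le hp hT (by linarith) hF L y hM hass⟩
  have hcard : 2 ≤ Fintype.card ((G.P₀ × A) ⊕ (G.P₀ × A)) := by
    have : 0 < G.P₀.card * Fintype.card A := Nat.mul_pos G.P₀_nonempty.card_pos Fintype.card_pos
    rw [Fintype.card_sum, Fintype.card_prod, Fintype.card_coe]
    omega
  obtain ⟨F, hF⟩ := exists_isUnbiasedForecaster hT hcard (G.events aStar pStar)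
  exact ⟨F, fun y => (hF y).trans hK⟩
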